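/- **Proposition (asymptotic normality of the sample-split rank-sum statistic).** Let $P_X$ be a probability measure on a measurable space $\mathcal X$, let $\mathcal L$ be a finite label set, and let $\eta,\hat\eta$ be measurable maps from $\mathcal X$ to the probability vectors on $\mathcal L$. Let $Z_i=(X_i,Y_i,Y_i')$, $i\ge 0$, be i.i.d. triples such that $X_i\sim P_X$ and, given $X_i$, $Y_i\sim\mathrm{Cat}(\eta(X_i))$ and $Y_i'\sim\mathrm{Cat}(\hat\eta(X_i))$ are independent. Let $\zeta_i,\zeta_i'$ be i.i.d. tie-breaking marks with an arbitrary law $\nu$ on $\mathbb R$, independent of the triples ($\nu$ a Dirac mass: no tie-breaking; $\nu$ uniform on $[0,1]$: random tie-breaking). A distinguisher procedure is a measurable rule that turns a data set $\mathcal D$ of triples, of any size, into a score $\hat g_{\mathcal D}:\mathcal X\times\mathcal L\to\mathbb R$; measurability is joint in $(\mathcal D,x,y)$. For marked points put $R_{\mathcal D}\big((x,y,z),(x',y',z')\big)=\mathbf 1\{\hat g_{\mathcal D}(x,y)<\hat g_{\mathcal D}(x',y')\}+\mathbf 1\{\hat g_{\mathcal D}(x,y)=\hat g_{\mathcal D}(x',y')\}\,\mathbf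 1\{z<z'\}$. When $\nu$ is a Dirac mass this is almost surely just $\mathbf 1\{\hat g_{\mathcal D}(x,y)<\hat g_{\mathcal D}(x',y')\}$. Let $(X,Y,\zeta)\sim (P_X\times\mathrm{Cat}(\eta(X)))\otimes\nu$ and $(X',Y',\zeta')\sim (P_X\times\mathrm{Cat}(\hat\eta(X')))\otimes\nu$ be independent, and, for fixed $\mathcal D$, set $$\phi(x,y,z;\mathcal D)=\mathbb E\,R_{\mathcal D}\big((x,y,z),(X',Y',\zeta')\big),\qquad \psi(x',y',z';\mathcal D)=\mathbb E\,R_{\mathcal D}\big((X,Y,\zeta),(x',y',z')\big),$$ $$\mu(\mathcal D)=\mathbb E\,R_{\mathcal D}\big((X,Y,\zeta),(X',Y',\zeta')\big),\qquad \sigma^2(\mathcal D)=\mathrm{Var}\big(\phi(X_*,Y_*,\zeta_*;\mathcal D)+\psi(X_*,Y_*',\zeta_*';\mathcal D)\big),\quad \sigma(\mathcal D)\ge 0,$$ where $(X_*,Y_*,Y'_*,\zeta_*,\zeta'_*)$ is a fresh copy of $(X_i,Y_i,Y_i',\zeta_i,\zeta_i')$. For each $n$ let $\mathcal I_{n,1},\mathcal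 I_{n,2}$ be disjoint finite index sets of sizes $n_1,n_2$ (depending on $n$), with $n_1\to\infty$ and $n_2\to\infty$ as $n\to\infty$. Let $\mathcal D_{n,1}=(Z_i)_{i\in\mathcal I_{n,1}}$, $\sigma_{n,split}=\sigma(\mathcal D_{n,1})$, and $$T_{n,split}=\frac1{n_2^2}\sum_{i,j\in\mathcal I_{n,2}}R_{\mathcal D_{n,1}}\big((X_i,Y_i,\zeta_i),(X_j,Y_j',\zeta_j')\big).$$ Assume that $\sigma_{n,split}^3\sqrt{n_2}\to\infty$ in probability, i.e. $\mathbb P(\sigma_{n,split}^3\sqrt{n_2}\le M)\to0$ for every $M\in\mathbb R$. Then $$\frac{\sqrt{n_2}}{\sigma_{n,split}}\big(T_{n,split}-\mu(\mathcal D_{n,1})\big)\xrightarrow{d}\mathcal N(0,1).$$ (Where $\sigma_{n,split}=0$, an event of vanishing probability, the quotient is read as $0$.) -/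

import Mathlib

open MeasureTheory ProbabilityTheory Filter Topology

namespace RankSum

/-- The categorical distribution `Cat(p)` on a finite label set, for a probability vector `p`. -/
noncomputable def cat {L : Type*} [Fintype L] [MeasurableSpace L] (p : stdSimplex ℝ L) :
    Measure L :=
  ∑ y : L, ENNReal.ofReal (p.1 y) • Measure.dirac y

/-- A (measurable) map `x ↦ η(x)` from the feature space to probability vectors on the labels. -/
structure ProbClassifier (X L : Type*) [Fintype L] [MeasurableSpace X] where
  toFun : X → stdSimplex ℝ L
  measurable_toFun : Measurable toFun

/-- The Markov kernel `x ↦ Cat(η(x))`. -/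
noncomputable def ProbClassifier.kernel {X L : Type*} [Fintype L] [MeasurableSpace X]
    [MeasurableSpace L] (η : ProbClassifier X L) : Kernel X L where
  toFun x := cat (η.toFun x)
  measurable' := by
    refine Measure.measurable_of_measurable_coe _ fun s _ => ?_
    have h : ∀ x, cat (η.toFun x) s
        = ∑ y : L, ENNReal.ofReal ((η.toFun x).1 y) * Measure.dirac y s := by
      intro x
      simp [cat, Measure.finsetSum_apply]
    simp only [h]
    refine Finset.measurable_sum _ fun y _ => Measurable.mul_const ?_ _
    exact ENNReal.measurable_ofReal.comp
      ((measurable_pi_apply y).comp (measurable_subtype_coe.comp η.measurable_toFun))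

instance {X L : Type*} [Fintype L] [MeasurableSpace X] [MeasurableSpace L]
    (η : ProbClassifier X L) : IsMarkovKernel η.kernel where
  isProbabilityMeasure x := by
    constructor
    change cat (η.toFun x) Set.univ = 1
    have h2 := (η.toFun x).2
    simp only [cat, Measure.finsetSum_apply, Measure.smul_apply, measure_univ, smul_eq_mul,
      mul_one]
    rw [← ENNReal.ofReal_sum_of_nonneg (fun y _ => h2.1 y), h2.2, ENNReal.ofReal_one]

section Population

variable {X L : Type*} [Fintype L] [MeasurableSpace X] [MeasurableSpace L]

/-- The law `P_X × Cat(η(X))` of a labelled point, together with an independent tie-breaking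
mark of law `ν`. -/
noncomputable def pointLaw (PX : Measure X) (η : ProbClassifier X L) (ν : Measure ℝ) :
    Measure ((X × L) × ℝ) :=
  (PX ⊗ₘ η.kernel).prod ν

/-- The law `P_X × Cat(η(X)) × Cat(ηhat(X))` of a triple `(X, Y, Y')`, where `Y` and `Y'` are
conditionally independent given `X`, together with independent marks `(ζ, ζ')` of law `ν`. -/
noncomputable def tripleLaw (PX : Measure X) (η ηhat : ProbClassifier X L) (ν : Measure ℝ) :
    Measure ((X × L × L) × ℝ × ℝ) :=
  (PX ⊗ₘ (η.kernel ×ₖ ηhat.kernel)).prod (ν.prod ν)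

open Classical in
/-- The rank comparison of two marked points under the score `g`: the indicator of
`g(x,y) < g(x',y')`, ties in the scores being decided by the marks.
If the law `ν` of the marks is a Dirac mass, this is almost surely the plain indicator
`1(g(x,y) < g(x',y'))`; if it is uniform on `[0,1]`, ties are broken at random. -/
noncomputable def rankInd (g : X → L → ℝ) (p q : (X × L) × ℝ) : ℝ :=
  if g p.1.1 p.1.2 < g q.1.1 q.1.2 ∨ (g p.1.1 p.1.2 = g q.1.1 q.1.2 ∧ p.2 < q.2) then 1 else 0

/-- First projection: `φ(x,y) = E_{X',Y'} 1(g(x,y) < g(X',Y'))`, `(X',Y') ∼ P_X × Cat(ηhat(X))`. -/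
noncomputable def phi (PX : Measure X) (ηhat : ProbClassifier X L) (ν : Measure ℝ)
    (g : X → L → ℝ) (p : (X × L) × ℝ) : ℝ :=
  ∫ q, rankInd g p q ∂(pointLaw PX ηhat ν)

/-- Second projection: `ψ(x',y') = E_{X,Y} 1(g(X,Y) < g(x',y'))`, `(X,Y) ∼ P_X × Cat(η(X))`. -/
noncomputable def psi (PX : Measure X) (η : ProbClassifier X L) (ν : Measure ℝ)
    (g : X → L → ℝ) (q : (X × L) × ℝ) : ℝ :=
  ∫ p, rankInd g p q ∂(pointLaw PX η ν)

/-- The mean `μ` of the rank comparison for independent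
`(X,Y) ∼ P_X × Cat(η(X))` and `(X',Y') ∼ P_X × Cat(ηhat(X'))`. -/
noncomputable def rankMean (PX : Measure X) (η ηhat : ProbClassifier X L) (ν : Measure ℝ)
    (g : X → L → ℝ) : ℝ :=
  ∫ r, rankInd g r.1 r.2 ∂((pointLaw PX η ν).prod (pointLaw PX ηhat ν))

/-- The standard deviation `σ` of `φ(X,Y) + ψ(X,Y')` for a fresh triple `(X,Y,Y')`,
the score `g` being held fixed. -/
noncomputable def rankSD (PX : Measure X) (η ηhat : ProbClassifier X L) (ν : Measure ℝ)
    (g : X → L → ℝ) : ℝ :=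
  Real.sqrt (variance
    (fun w : (X × L × L) × ℝ × ℝ =>
      phi PX ηhat ν g ((w.1.1, w.1.2.1), w.2.1) + psi PX η ν g ((w.1.1, w.1.2.2), w.2.2))
    (tripleLaw PX η ηhat ν))

end Population

section Sample

variable {X L Ω : Type*}

/-- With equal marks, the rank comparison is the plain strict indicator. -/
theorem rankInd_of_mark_eq (g : X → L → ℝ) (x x' : X) (y y' : L) (c : ℝ)
    [Decidable (g x y < g x' y')] :
    rankInd g ((x, y), c) ((x', y'), c) = if g x y < g x' y' then 1 else 0 := by
  simp [rankInd]

/-- A distinguisher procedure: it turns a data set of any size `m`, made of triples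
`(X_i, Y_i, Y'_i)`, into a score function on labelled points. -/
abbrev Distinguisher (X L : Type*) := (m : ℕ) → (Fin m → X × L × L) → X → L → ℝ

/-- The score `ĝ` fitted on the triples with index in `I` (listed in increasing order). -/
def fittedScore (D : Distinguisher X L) (Z : ℕ → Ω → X × L × L) (I : Finset ℕ) (ω : Ω) :
    X → L → ℝ :=
  D I.card fun k => Z (I.orderEmbOfFin rfl k) ω

/-- The rank-sum statistic `|I|⁻² ∑_{i,j ∈ I} R_{ij}` with
`R_{ij} = 1(g(X_i,Y_i) < g(X_j,Y'_j))`. -/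
noncomputable def rankSum (g : X → L → ℝ) (Z : ℕ → Ω → X × L × L) (ζ ζ' : ℕ → Ω → ℝ)
    (I : Finset ℕ) (ω : Ω) : ℝ :=
  1 / (I.card : ℝ) ^ 2 * ∑ i ∈ I, ∑ j ∈ I,
    rankInd g (((Z i ω).1, (Z i ω).2.1), ζ i ω) (((Z j ω).1, (Z j ω).2.2), ζ' j ω)

/-- Divergence to `+∞` in probability. -/
def TendstoInProbAtTop [MeasurableSpace Ω] (P : Measure Ω) (V : ℕ → Ω → ℝ) : Prop :=
  ∀ M : ℝ, Tendsto (fun n => P {ω | V n ω ≤ M}) atTop (𝓝 0)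

end Sample

end RankSum

namespace RankSum

/-! ### Elementary inequalities for exponentials and powers -/

section Estimates

/-! Freeze the training split. The score is then a fixed function, and the statistic is a
V-statistic of i.i.d. marked triples whose kernel has values in `[0,1]`. Its Hoeffding
decomposition, with `m` the size of the second split, is `T - μ = m⁻¹ ∑ ξ(W i) + m⁻² ∑ r(W i, W j)`,
where `ξ` is the centered sum of the two projections, of variance `σ²`, and `r` integrates to zero
in either argument.

After scaling by `√m / σ`, the linear part has a characteristic function within `O(1/(σ√m) + 1/m)`
of the Gaussian one, for fixed `t`. The terms of the double sum of `r` over distinct indices are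
orthogonal up to swapping the indices, so the whole sum is `O(m)` in `L¹` and perturbs the
characteristic function by `O(1/(σ√m))`. Both are combined in
`norm_charFun_standardizedVStat_sub_le`, whose error depends on the kernel only through `σ`.

This uniformity allows the score to be random: the splits are independent, so Fubini averages the
bound over the training data, with the trivial bound `2` where `σ√m` is small
(`norm_integral_exp_standardizedVStat_sub_le`). Lévy's continuity theorem concludes. The argument
needs only `σ√m → ∞` in probability, which follows from the assumption on `σ³√m` because `σ ≤ 1`. -/

theorem norm_exp_ofReal_mul_I_sub_taylor_le (x : ℝ) :
    ‖Complex.exp (x * Complex.I) - (1 + x * Complex.I - (x : ℂ) ^ 2 / 2)‖ ≤ 5 * |x| ^ 3 := by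
  have hn : ‖(x : ℂ) * Complex.I‖ = |x| := by simp
  rcases le_or_gt |x| 1 with hx | hx
  · have h := Complex.exp_bound (x := x * Complex.I) (by rwa [hn]) (n := 3) (by norm_num)
    rw [hn] at h
    have e : ∑ m ∈ Finset.range 3, ((x : ℂ) * Complex.I) ^ m / (m.factorial : ℂ)
        = 1 + x * Complex.I - (x : ℂ) ^ 2 / 2 := by
      simp [Finset.sum_range_succ, mul_pow, Nat.factorial]
      ring
    rw [e] at h
    refine h.trans ?_
    rw [mul_comm]
    gcongr
    norm_num [Nat.factorial]
  · have h1 : ‖Complex.exp (x * Complex.I) - (1 + x * Complex.I - (x : ℂ) ^ 2 / 2)‖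
        ≤ 1 + (1 + |x| + |x| ^ 2 / 2) := by
      refine (norm_sub_le _ _).trans (add_le_add (Complex.norm_exp_ofReal_mul_I x).le ?_)
      refine (norm_sub_le _ _).trans (add_le_add ((norm_add_le _ _).trans ?_) ?_)
      · simp
      · simp
    have h2 : |x| ≤ |x| ^ 3 := le_self_pow₀ hx.le (by norm_num)
    have h3 : |x| ^ 2 ≤ |x| ^ 3 := pow_le_pow_right₀ hx.le (by norm_num)
    linarith

/-- Telescoping: one factor is exchanged at a time, and the others have norm at most one. -/
theorem norm_pow_sub_pow_le {a b : ℂ} (ha : ‖a‖ ≤ 1) (hb : ‖b‖ ≤ 1) (n : ℕ) :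
    ‖a ^ n - b ^ n‖ ≤ n * ‖a - b‖ := by
  induction n with
  | zero => simp
  | succ n ih =>
    have e : a ^ (n + 1) - b ^ (n + 1) = (a ^ n - b ^ n) * a + b ^ n * (a - b) := by ring
    rw [e]
    refine (norm_add_le _ _).trans ?_
    rw [norm_mul, norm_mul, norm_pow]
    have h1 : ‖a ^ n - b ^ n‖ * ‖a‖ ≤ ‖a ^ n - b ^ n‖ := mul_le_of_le_one_right (norm_nonneg _) ha
    have h2 : ‖b‖ ^ n * ‖a - b‖ ≤ ‖a - b‖ :=
      mul_le_of_le_one_left (norm_nonneg _) (pow_le_one₀ (norm_nonneg _) hb)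
    push_cast
    linarith

theorem abs_exp_neg_sub_le {x : ℝ} (hx : 0 ≤ x) : |Real.exp (-x) - (1 - x)| ≤ x ^ 2 := by
  have h1 := Real.one_sub_le_exp_neg x
  rw [abs_of_nonneg (by linarith), Real.exp_neg]
  have h2 : x + 1 ≤ Real.exp x := Real.add_one_le_exp x
  have h3 : (Real.exp x)⁻¹ ≤ (x + 1)⁻¹ := inv_anti₀ (by linarith) h2
  -- Because `(1 + x)(1 - x + x²) = 1 + x³`.
  have h4 : (x + 1)⁻¹ ≤ 1 - x + x ^ 2 := by
    rw [inv_le_iff_one_le_mul₀ (by linarith)]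
    nlinarith [pow_nonneg hx 3]
  linarith

end Estimates

/-! ### Quantitative central limit theorem for bounded i.i.d. summands -/

section CLT

variable {Ω E : Type*} [MeasurableSpace Ω] [MeasurableSpace E] {P : Measure Ω}
  {Q : Measure E} [IsProbabilityMeasure Q] {W : ℕ → Ω → E}

theorem integrable_of_abs_le {μ : Measure E} [IsFiniteMeasure μ] {f : E → ℝ} {C : ℝ}
    (hf : Measurable f) (hC : ∀ x, |f x| ≤ C) : Integrable f μ :=
  .of_bound hf.aestronglyMeasurable C (.of_forall hC)

/-- Taylor expansion under the integral; centering kills the linear term. The cubic error is reduced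
by `|ξ|³ ≤ 2 ξ²`, which turns the constant `5` into `10` and keeps the error proportional to the
variance. -/
theorem norm_charFun_map_sub_le {ξ : E → ℝ} (hξ : Measurable ξ) (hb : ∀ x, |ξ x| ≤ 2)
    (h0 : ∫ x, ξ x ∂Q = 0) (s : ℝ) :
    ‖charFun (Q.map ξ) s - (1 - s ^ 2 * (∫ x, ξ x ^ 2 ∂Q) / 2 : ℝ)‖
      ≤ 10 * |s| ^ 3 * ∫ x, ξ x ^ 2 ∂Q := by
  have i1 : Integrable ξ Q := integrable_of_abs_le hξ hb
  have i2 : Integrable (fun x => ξ x ^ 2) Q := by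
    refine integrable_of_abs_le (C := 2 ^ 2) (hξ.pow_const 2) fun x => ?_
    rw [abs_pow]
    exact pow_le_pow_left₀ (abs_nonneg _) (hb x) 2
  have i3 : Integrable (fun x => Complex.exp (s * ξ x * Complex.I)) Q := by
    refine .of_bound (by fun_prop) 1 (.of_forall fun x => ?_)
    rw [← Complex.ofReal_mul, Complex.norm_exp_ofReal_mul_I]
  have j1 : Integrable (fun x => ((s * ξ x : ℝ) : ℂ) * Complex.I) Q :=
    ((i1.const_mul s).ofReal (𝕜 := ℂ)).mul_const _
  have j2 : Integrable (fun x => (((s * ξ x) ^ 2 / 2 : ℝ) : ℂ)) Q := by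
    refine Integrable.ofReal (𝕜 := ℂ) ?_
    simp_rw [mul_pow]
    exact (i2.const_mul _).div_const _
  have j3 : Integrable (fun x => 1 + ((s * ξ x : ℝ) : ℂ) * Complex.I) Q :=
    (integrable_const _).add j1
  have j4 : Integrable (fun x => 1 + ((s * ξ x : ℝ) : ℂ) * Complex.I
      - (((s * ξ x) ^ 2 / 2 : ℝ) : ℂ)) Q := j3.sub j2
  have e : charFun (Q.map ξ) s - (1 - s ^ 2 * (∫ x, ξ x ^ 2 ∂Q) / 2 : ℝ)
      = ∫ x, (Complex.exp (((s * ξ x : ℝ) : ℂ) * Complex.I)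
          - (1 + ((s * ξ x : ℝ) : ℂ) * Complex.I - (((s * ξ x) ^ 2 / 2 : ℝ) : ℂ))) ∂Q := by
    rw [integral_sub (by simpa using i3) j4, integral_sub j3 j2, integral_add (integrable_const _) j1,
      integral_mul_const, integral_complex_ofReal, integral_complex_ofReal,
      integral_const_mul, h0, charFun_apply_real, integral_map hξ.aemeasurable (by fun_prop)]
    simp_rw [mul_pow, integral_div, integral_const_mul]
    simp
  rw [e, ← integral_const_mul]
  refine norm_integral_le_of_norm_le (i2.const_mul _) (.of_forall fun x => ?_)
  have h := norm_exp_ofReal_mul_I_sub_taylor_le (s * ξ x)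
  push_cast at h ⊢
  refine h.trans ?_
  rw [abs_mul, mul_pow]
  have h2 : |ξ x| ^ 3 ≤ 2 * ξ x ^ 2 := by
    rw [pow_succ, sq_abs, mul_comm]
    exact mul_le_mul_of_nonneg_right (hb x) (sq_nonneg _)
  have := mul_le_mul_of_nonneg_left h2 (pow_nonneg (abs_nonneg s) 3)
  linarith

/-- Both characteristic functions are `m`-th powers, so their distance is at most `m` times that of
the bases, taken at `s = t / (σ√m)`. The cubic error contributes `10 m |s|³ σ² = 10 |t|³ / (σ√m)`.
-/
theorem norm_charFun_normalized_sum_sub_le (hW : ∀ i, HasLaw (W i) Q P) (hind : iIndepFun W P)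
    {ξ : E → ℝ} (hξ : Measurable ξ) (hb : ∀ x, |ξ x| ≤ 2) (h0 : ∫ x, ξ x ∂Q = 0)
    {σ : ℝ} (hσ : 0 < σ) (hσ2 : ∫ x, ξ x ^ 2 ∂Q = σ ^ 2) {T : Finset ℕ} (hT : 0 < T.card) (t : ℝ) :
    ‖charFun (P.map fun ω => (σ * √(T.card : ℝ))⁻¹ * ∑ i ∈ T, ξ (W i ω)) t
        - Real.exp (-(t ^ 2 / 2))‖
      ≤ 10 * |t| ^ 3 / (σ * √(T.card : ℝ)) + t ^ 4 / (4 * T.card) := by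
  set m : ℝ := (T.card : ℝ) with hm
  have hmpos : 0 < m := by rw [hm]; exact_mod_cast hT
  have hsq : √m ^ 2 = m := Real.sq_sqrt hmpos.le
  have hs : 0 < √m := Real.sqrt_pos.2 hmpos
  have hWm : ∀ i, AEMeasurable (fun ω => ξ (W i ω)) P :=
    fun i => hξ.comp_aemeasurable (hW i).aemeasurable
  have hmap : ∀ i, P.map (fun ω => ξ (W i ω)) = Q.map ξ := fun i => by
    rw [← (hW i).map_eq, AEMeasurable.map_map_of_aemeasurable hξ.aemeasurable (hW i).aemeasurable]
    rfl
  have hcf : charFun (P.map fun ω => (σ * √m)⁻¹ * ∑ i ∈ T, ξ (W i ω)) t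
      = charFun (Q.map ξ) ((σ * √m)⁻¹ * t) ^ T.card := by
    have hi : iIndepFun (fun i ω => ξ (W i ω)) P := hind.comp (fun _ => ξ) fun _ => hξ
    rw [charFun_map_mul_comp (Finset.aemeasurable_fun_sum _ fun i _ => hWm i),
      (hi.restrict _).charFun_map_fun_finsetSum_eq_prod (fun i _ => hWm i)]
    simp [hmap]
  set s : ℝ := (σ * √m)⁻¹ * t with hsdef
  have hprob : IsProbabilityMeasure (Q.map ξ) := Measure.isProbabilityMeasure_map hξ.aemeasurable
  have hexp : ((Real.exp (-(t ^ 2 / 2)) : ℝ) : ℂ)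
      = ((Real.exp (-(t ^ 2 / (2 * m))) : ℝ) : ℂ) ^ T.card := by
    rw [← Complex.ofReal_pow, ← Real.exp_nat_mul, ← hm]
    congr 2
    field_simp
  rw [hcf, hexp]
  have hx : 0 ≤ t ^ 2 / (2 * m) := by positivity
  refine (norm_pow_sub_pow_le (norm_charFun_le_one _) ?_ _).trans ?_
  · rw [Complex.norm_real, Real.norm_eq_abs, abs_of_pos (Real.exp_pos _)]
    exact Real.exp_le_one_iff.2 (by linarith)
  have k1 := norm_charFun_map_sub_le hξ hb h0 s
  rw [hσ2] at k1
  have k2 := abs_exp_neg_sub_le hx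
  have hs2 : s ^ 2 * σ ^ 2 / 2 = t ^ 2 / (2 * m) := by
    rw [hsdef, mul_pow, inv_pow, mul_pow, hsq]
    field_simp
  rw [hs2] at k1
  have hs3 : |s| ^ 3 * σ ^ 2 * m = |t| ^ 3 / (σ * √m) := by
    rw [hsdef, abs_mul, abs_of_pos (by positivity : 0 < (σ * √m)⁻¹)]
    nth_rewrite 2 [← hsq]
    field_simp
  have k3 : ‖charFun (Q.map ξ) s - ((Real.exp (-(t ^ 2 / (2 * m))) : ℝ) : ℂ)‖
      ≤ 10 * |s| ^ 3 * σ ^ 2 + (t ^ 2 / (2 * m)) ^ 2 := by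
    refine (norm_sub_le_norm_sub_add_norm_sub _ ((1 - t ^ 2 / (2 * m) : ℝ) : ℂ) _).trans
      (add_le_add k1 ?_)
    rw [← Complex.ofReal_sub, Complex.norm_real, Real.norm_eq_abs, abs_sub_comm]
    exact k2
  refine (mul_le_mul_of_nonneg_left k3 hmpos.le).trans (le_of_eq ?_)
  have : m * (t ^ 2 / (2 * m)) ^ 2 = t ^ 4 / (4 * m) := by field_simp; norm_num
  rw [mul_add, this, mul_div_assoc, ← hs3]
  ring

end CLT

/-! ### Hoeffding decomposition of a kernel with values in `[0,1]` -/

section Hoeffding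

variable {Ω E : Type*} [MeasurableSpace Ω] [MeasurableSpace E]

/-- The first Hájek projection of a kernel `h`. -/
noncomputable def projLeft (Q : Measure E) (h : E → E → ℝ) (w : E) : ℝ := ∫ w', h w w' ∂Q

/-- The second Hájek projection of a kernel `h`. -/
noncomputable def projRight (Q : Measure E) (h : E → E → ℝ) (w' : E) : ℝ := ∫ w, h w w' ∂Q

/-- The mean of a kernel `h` over independent arguments. -/
noncomputable def kernelMean (Q : Measure E) (h : E → E → ℝ) : ℝ := ∫ w, projLeft Q h w ∂Q

/-- The standard deviation of the sum of the two Hájek projections. -/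
noncomputable def projSD (Q : Measure E) (h : E → E → ℝ) : ℝ :=
  √(variance (fun w => projLeft Q h w + projRight Q h w) Q)

/-- The degenerate part of the Hoeffding decomposition of a kernel `h`. -/
noncomputable def degeneratePart (Q : Measure E) (h : E → E → ℝ) (w w' : E) : ℝ :=
  h w w' - projLeft Q h w - projRight Q h w' + kernelMean Q h

/-- The V-statistic with kernel `h` over the sample points with index in `T`. -/
noncomputable def vStat (h : E → E → ℝ) (W : ℕ → Ω → E) (T : Finset ℕ) (ω : Ω) : ℝ :=
  1 / (T.card : ℝ) ^ 2 * ∑ i ∈ T, ∑ j ∈ T, h (W i ω) (W j ω)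

/-- The standardized V-statistic. -/
noncomputable def standardizedVStat (Q : Measure E) (h : E → E → ℝ) (W : ℕ → Ω → E)
    (T : Finset ℕ) (ω : Ω) : ℝ :=
  √(T.card : ℝ) / projSD Q h * (vStat h W T ω - kernelMean Q h)

variable {P : Measure Ω} [IsProbabilityMeasure P] {Q : Measure E} [IsProbabilityMeasure Q]
  {W : ℕ → Ω → E} {h : E → E → ℝ}

theorem integral_mem_Icc {f : E → ℝ} (hf : ∀ x, f x ∈ Set.Icc (0 : ℝ) 1) :
    ∫ x, f x ∂Q ∈ Set.Icc (0 : ℝ) 1 := by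
  refine ⟨integral_nonneg fun x => (hf x).1, ?_⟩
  have := norm_integral_le_of_norm_le_const (μ := Q) (f := f) (C := 1)
    (.of_forall fun x => by rw [Real.norm_eq_abs, abs_of_nonneg (hf x).1]; exact (hf x).2)
  simp only [probReal_univ, mul_one] at this
  exact (le_abs_self _).trans this

section Measurability

variable (hm : Measurable (Function.uncurry h))
include hm

theorem measurable_projLeft : Measurable (projLeft Q h) :=
  (StronglyMeasurable.integral_prod_right (ν := Q) hm.stronglyMeasurable).measurable

theorem measurable_projRight : Measurable (projRight Q h) :=
  (StronglyMeasurable.integral_prod_left (μ := Q) hm.stronglyMeasurable).measurable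

theorem measurable_degeneratePart : Measurable (Function.uncurry (degeneratePart Q h)) :=
  ((hm.sub ((measurable_projLeft hm).comp measurable_fst)).sub
    ((measurable_projRight hm).comp measurable_snd)).add_const _

end Measurability

section Bounds

variable (hI : ∀ w w', h w w' ∈ Set.Icc (0 : ℝ) 1)
include hI

theorem projLeft_mem_Icc (w : E) : projLeft Q h w ∈ Set.Icc (0 : ℝ) 1 := integral_mem_Icc (hI w)

theorem projRight_mem_Icc (w : E) : projRight Q h w ∈ Set.Icc (0 : ℝ) 1 :=
  integral_mem_Icc fun x => hI x w

theorem kernelMean_mem_Icc : kernelMean Q h ∈ Set.Icc (0 : ℝ) 1 :=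
  integral_mem_Icc (projLeft_mem_Icc hI)

theorem abs_degeneratePart_le (w w' : E) : |degeneratePart Q h w w'| ≤ 2 := by
  have h1 := hI w w'
  have h2 := projLeft_mem_Icc (Q := Q) hI w
  have h3 := projRight_mem_Icc (Q := Q) hI w'
  have h4 := kernelMean_mem_Icc (Q := Q) hI
  rw [Set.mem_Icc] at h1 h2 h3 h4
  rw [degeneratePart, abs_le]
  constructor <;> linarith

theorem abs_centered_proj_le (w : E) :
    |projLeft Q h w + projRight Q h w - 2 * kernelMean Q h| ≤ 2 := by
  have h2 := projLeft_mem_Icc (Q := Q) hI w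
  have h3 := projRight_mem_Icc (Q := Q) hI w
  have h4 := kernelMean_mem_Icc (Q := Q) hI
  rw [Set.mem_Icc] at h2 h3 h4
  rw [abs_le]
  constructor <;> linarith

end Bounds

section Both

variable (hm : Measurable (Function.uncurry h)) (hI : ∀ w w', h w w' ∈ Set.Icc (0 : ℝ) 1)
include hm hI

theorem integrable_projLeft : Integrable (projLeft Q h) Q :=
  integrable_of_abs_le (C := 1) (measurable_projLeft hm) fun w => by
    rw [abs_of_nonneg (projLeft_mem_Icc hI w).1]; exact (projLeft_mem_Icc hI w).2

theorem integrable_projRight : Integrable (projRight Q h) Q :=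
  integrable_of_abs_le (C := 1) (measurable_projRight hm) fun w => by
    rw [abs_of_nonneg (projRight_mem_Icc hI w).1]; exact (projRight_mem_Icc hI w).2

theorem integrable_section_left (w : E) : Integrable (h w) Q :=
  integrable_of_abs_le (C := 1) (hm.comp measurable_prodMk_left) fun w' => by
    rw [abs_of_nonneg (hI w w').1]; exact (hI w w').2

theorem integrable_section_right (w' : E) : Integrable (fun w => h w w') Q :=
  integrable_of_abs_le (C := 1) (hm.comp measurable_prodMk_right) fun w => by
    rw [abs_of_nonneg (hI w w').1]; exact (hI w w').2

theorem integral_projRight : ∫ w, projRight Q h w ∂Q = kernelMean Q h := by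
  refine integral_integral_swap (integrable_of_abs_le (C := 1) ?_ fun p => ?_)
  · exact hm.comp measurable_swap
  · exact (abs_of_nonneg (hI p.2 p.1).1).trans_le (hI p.2 p.1).2

theorem integral_degeneratePart_right (w : E) : ∫ w', degeneratePart Q h w w' ∂Q = 0 := by
  have i1 : Integrable (fun w' => h w w' - projLeft Q h w) Q :=
    (integrable_section_left hm hI w).sub (integrable_const _)
  have i2 : Integrable (fun w' => h w w' - projLeft Q h w - projRight Q h w') Q :=
    i1.sub (integrable_projRight hm hI)
  simp only [degeneratePart]
  rw [integral_add i2 (integrable_const _), integral_sub i1 (integrable_projRight hm hI),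
    integral_sub (integrable_section_left hm hI w) (integrable_const _),
    integral_projRight hm hI]
  simp [projLeft]

theorem integral_degeneratePart_left (w' : E) : ∫ w, degeneratePart Q h w w' ∂Q = 0 := by
  have i1 : Integrable (fun w => h w w' - projLeft Q h w) Q :=
    (integrable_section_right hm hI w').sub (integrable_projLeft hm hI)
  have i2 : Integrable (fun w => h w w' - projLeft Q h w - projRight Q h w') Q :=
    i1.sub (integrable_const _)
  simp only [degeneratePart]
  rw [integral_add i2 (integrable_const _), integral_sub i1 (integrable_const _),
    integral_sub (integrable_section_right hm hI w') (integrable_projLeft hm hI)]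
  simp [projRight, kernelMean]

theorem integral_projLeft_add_projRight :
    ∫ w, (projLeft Q h w + projRight Q h w) ∂Q = 2 * kernelMean Q h := by
  rw [integral_add (integrable_projLeft hm hI) (integrable_projRight hm hI),
    integral_projRight hm hI, two_mul]
  rfl

theorem integral_centered_proj :
    ∫ w, (projLeft Q h w + projRight Q h w - 2 * kernelMean Q h) ∂Q = 0 := by
  have i1 : Integrable (fun w => projLeft Q h w + projRight Q h w) Q :=
    (integrable_projLeft hm hI).add (integrable_projRight hm hI)
  rw [integral_sub i1 (integrable_const _), integral_projLeft_add_projRight hm hI]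
  simp

theorem integral_centered_proj_sq :
    ∫ w, (projLeft Q h w + projRight Q h w - 2 * kernelMean Q h) ^ 2 ∂Q = projSD Q h ^ 2 := by
  have hmeas : Measurable fun w => projLeft Q h w + projRight Q h w :=
    (measurable_projLeft hm).add (measurable_projRight hm)
  rw [projSD, Real.sq_sqrt (variance_nonneg _ _), variance_eq_integral hmeas.aemeasurable,
    integral_projLeft_add_projRight hm hI]

/-- Popoviciu's inequality for a variable with values in `[0,2]`. This is what allows `σ³` to be
replaced by `σ` in the hypothesis of the main theorem. -/
theorem projSD_le_one : projSD Q h ≤ 1 := by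
  have h1 := variance_le_sq_of_bounded (μ := Q) (a := 0) (b := 2)
    (X := fun w => projLeft Q h w + projRight Q h w) (.of_forall fun w => by
      have h2 := projLeft_mem_Icc (Q := Q) hI w
      have h3 := projRight_mem_Icc (Q := Q) hI w
      exact ⟨add_nonneg h2.1 h3.1, by linarith [h2.2, h3.2]⟩)
    ((measurable_projLeft hm).add (measurable_projRight hm)).aemeasurable
  refine Real.sqrt_le_iff.2 ⟨zero_le_one, h1.trans (by norm_num)⟩

end Both

/-! ### The degenerate remainder and the bound for a fixed kernel -/

section Remainder

omit [IsProbabilityMeasure P] [IsProbabilityMeasure Q] in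
theorem aemeasurable_restrict (hW : ∀ i, HasLaw (W i) Q P) (S : Finset ℕ) :
    AEMeasurable (fun ω (i : S) => W i ω) P :=
  aemeasurable_pi_lambda _ fun i => (hW i).aemeasurable

/-- `W b` is independent of the block of the other variables, so it can be integrated out first,
which annihilates `k`. The indices `a`, `c`, `d` may coincide. -/
theorem integral_mul_eq_zero_of_notMem (hW : ∀ i, HasLaw (W i) Q P) (hind : iIndepFun W P)
    {k k' : E → E → ℝ} (hk : Measurable (Function.uncurry k)) {C : ℝ} (hC : ∀ w w', |k w w'| ≤ C)
    (hk' : Measurable (Function.uncurry k')) (hC' : ∀ w w', |k' w w'| ≤ C)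
    (h0 : ∀ w, ∫ w', k w w' ∂Q = 0) {a b c d : ℕ} (hb : b ∉ ({a, c, d} : Finset ℕ)) :
    ∫ ω, k (W a ω) (W b ω) * k' (W c ω) (W d ω) ∂P = 0 := by
  set S : Finset ℕ := {a, c, d} with hS
  have ha : a ∈ S := by simp [hS]
  have hc : c ∈ S := by simp [hS]
  have hd : d ∈ S := by simp [hS]
  have hin : IndepFun (fun ω (i : S) => W i ω) (W b) P := by
    have := hind.indepFun_finset₀ S {b} (Finset.disjoint_singleton_right.2 hb)
      (fun i => (hW i).aemeasurable)
    exact this.comp (φ := id) (ψ := fun v : ({b} : Finset ℕ) → E => v ⟨b, by simp⟩) measurable_id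
      (measurable_pi_apply _)
  have hp := (indepFun_iff_map_prod_eq_prod_map_map (aemeasurable_restrict hW S)
    (hW b).aemeasurable).1 hin
  rw [(hW b).map_eq] at hp
  have hpr : IsProbabilityMeasure (P.map fun ω (i : S) => W i ω) :=
    Measure.isProbabilityMeasure_map (aemeasurable_restrict hW S)
  let F : (S → E) × E → ℝ := fun p =>
    k (p.1 ⟨a, ha⟩) p.2 * k' (p.1 ⟨c, hc⟩) (p.1 ⟨d, hd⟩)
  have hF : Measurable F := by
    refine Measurable.mul ?_ ?_
    · exact hk.comp (f := fun p : (S → E) × E => (p.1 ⟨a, ha⟩, p.2)) (by fun_prop)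
    · exact hk'.comp (f := fun p : (S → E) × E => (p.1 ⟨c, hc⟩, p.1 ⟨d, hd⟩)) (by fun_prop)
  have e1 : ∫ ω, k (W a ω) (W b ω) * k' (W c ω) (W d ω) ∂P
      = ∫ p, F p ∂(P.map fun ω => ((fun (i : S) => W i ω), W b ω)) := by
    rw [integral_map ((aemeasurable_restrict hW S).prodMk (hW b).aemeasurable)
      hF.aestronglyMeasurable]
  have hC0 : 0 ≤ C := by
    obtain ⟨ω⟩ := P.nonempty_of_neZero
    exact (abs_nonneg _).trans (hC (W a ω) (W a ω))
  rw [e1, hp, integral_prod]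
  · simp [F, integral_mul_const, h0]
  · refine integrable_of_abs_le (C := C * C) hF fun p => ?_
    rw [abs_mul]
    exact mul_le_mul (hC _ _) (hC' _ _) (abs_nonneg _) hC0

omit [IsProbabilityMeasure P] in
theorem aemeasurable_degeneratePart (hW : ∀ i, HasLaw (W i) Q P)
    (hm : Measurable (Function.uncurry h)) (i j : ℕ) :
    AEMeasurable (fun ω => degeneratePart Q h (W i ω) (W j ω)) P :=
  (measurable_degeneratePart hm).comp_aemeasurable
    ((hW i).aemeasurable.prodMk (hW j).aemeasurable)

variable (hW : ∀ i, HasLaw (W i) Q P) (hind : iIndepFun W P)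
  (hm : Measurable (Function.uncurry h)) (hI : ∀ w w', h w w' ∈ Set.Icc (0 : ℝ) 1)
include hW hind hm hI

theorem integral_degeneratePart_mul_eq_zero {p q : ℕ × ℕ} (hp : p.1 ≠ p.2) (hq : q.1 ≠ q.2)
    (h1 : q ≠ p) (h2 : q ≠ p.swap) :
    ∫ ω, degeneratePart Q h (W p.1 ω) (W p.2 ω) * degeneratePart Q h (W q.1 ω) (W q.2 ω) ∂P
      = 0 := by
  have mr := measurable_degeneratePart (Q := Q) hm
  have br := abs_degeneratePart_le (Q := Q) hI
  obtain ⟨a, b⟩ := p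
  obtain ⟨c, d⟩ := q
  simp only [ne_eq, Prod.mk.injEq, Prod.swap_prod_mk] at hp hq h1 h2 ⊢
  -- If both `a` and `b` occurred in `{c, d}`, the pairs would agree up to order. So one of them
  -- occurs only once and can be integrated out.
  by_cases hb : b ∈ ({a, c, d} : Finset ℕ)
  · have ha : a ∉ ({b, c, d} : Finset ℕ) := by
      simp only [Finset.mem_insert, Finset.mem_singleton] at hb ⊢
      omega
    exact integral_mul_eq_zero_of_notMem hW hind (k := fun w w' => degeneratePart Q h w' w)
      (mr.comp measurable_swap) (fun w w' => br w' w) mr br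
      (integral_degeneratePart_left hm hI) ha
  · exact integral_mul_eq_zero_of_notMem hW hind mr br mr br
      (integral_degeneratePart_right hm hI) hb

/-- In the expanded square each pair `p` meets only `q = p` and `q = p.swap`, each product being at
most `2 * 2`; there are at most `m²` pairs. -/
theorem integral_sq_sum_offDiag_le (T : Finset ℕ) :
    ∫ ω, (∑ p ∈ T.offDiag, degeneratePart Q h (W p.1 ω) (W p.2 ω)) ^ 2 ∂P
      ≤ 8 * (T.card : ℝ) ^ 2 := by
  have br := abs_degeneratePart_le (Q := Q) hI
  have bp : ∀ (p q : ℕ × ℕ) ω,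
      |degeneratePart Q h (W p.1 ω) (W p.2 ω) * degeneratePart Q h (W q.1 ω) (W q.2 ω)| ≤ 4 := by
    intro p q ω
    rw [abs_mul]
    have := mul_le_mul (br (W p.1 ω) (W p.2 ω)) (br (W q.1 ω) (W q.2 ω)) (abs_nonneg _)
      (by norm_num)
    linarith
  have ip : ∀ p q : ℕ × ℕ, Integrable (fun ω =>
      degeneratePart Q h (W p.1 ω) (W p.2 ω) * degeneratePart Q h (W q.1 ω) (W q.2 ω)) P :=
    fun p q => .of_bound ((aemeasurable_degeneratePart hW hm _ _).mul
      (aemeasurable_degeneratePart hW hm _ _)).aestronglyMeasurable 4 (.of_forall (bp p q))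
  simp_rw [sq, Finset.sum_mul_sum]
  rw [integral_finsetSum _ fun p _ => integrable_finsetSum _ fun q _ => ip p q]
  have key : ∀ p ∈ T.offDiag, ∫ ω, ∑ q ∈ T.offDiag,
      degeneratePart Q h (W p.1 ω) (W p.2 ω) * degeneratePart Q h (W q.1 ω) (W q.2 ω) ∂P
      ≤ 8 := by
    intro p hp
    rw [integral_finsetSum _ fun q _ => ip p q]
    have hpq : ∀ q ∈ T.offDiag, ∫ ω,
        degeneratePart Q h (W p.1 ω) (W p.2 ω) * degeneratePart Q h (W q.1 ω) (W q.2 ω) ∂P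
        ≤ (if q = p then (4 : ℝ) else 0) + if q = p.swap then (4 : ℝ) else 0 := by
      intro q hq
      have hle : ∫ ω, degeneratePart Q h (W p.1 ω) (W p.2 ω)
          * degeneratePart Q h (W q.1 ω) (W q.2 ω) ∂P ≤ 4 := by
        have := norm_integral_le_of_norm_le_const (μ := P) (f := fun ω => degeneratePart Q h (W p.1 ω)
          (W p.2 ω) * degeneratePart Q h (W q.1 ω) (W q.2 ω)) (.of_forall (bp p q))
        simp only [probReal_univ, mul_one] at this
        exact (le_abs_self _).trans this
      by_cases h1 : q = p
      · rw [if_pos h1]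
        split_ifs <;> linarith
      by_cases h2 : q = p.swap
      · rw [if_neg h1, if_pos h2]
        linarith
      rw [integral_degeneratePart_mul_eq_zero hW hind hm hI (Finset.mem_offDiag.1 hp).2.2
        (Finset.mem_offDiag.1 hq).2.2 h1 h2]
      simp [h1, h2]
    refine (Finset.sum_le_sum hpq).trans ?_
    rw [Finset.sum_add_distrib, Finset.sum_ite_eq', Finset.sum_ite_eq']
    split_ifs
    all_goals norm_num
  refine (Finset.sum_le_card_nsmul _ _ _ key).trans ?_
  rw [Finset.offDiag_card, nsmul_eq_mul, mul_comm]
  refine mul_le_mul_of_nonneg_left ?_ (by norm_num)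
  rw [← Nat.cast_mul]
  exact_mod_cast Nat.sub_le _ _

/-- The diagonal costs `2m`. Off the diagonal, `|Y| ≤ m/2 + Y²/(2m)` and the second moment bound
`8m²` give `m/2 + 4m`; the total `6.5 m` is rounded up. -/
theorem integral_abs_sum_degeneratePart_le (T : Finset ℕ) (hT : 0 < T.card) :
    ∫ ω, |∑ i ∈ T, ∑ j ∈ T, degeneratePart Q h (W i ω) (W j ω)| ∂P ≤ 7 * T.card := by
  have br := abs_degeneratePart_le (Q := Q) hI
  have hmpos : (0 : ℝ) < T.card := by exact_mod_cast hT
  set m : ℝ := (T.card : ℝ) with hmdef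
  set Y : Ω → ℝ := fun ω => ∑ p ∈ T.offDiag, degeneratePart Q h (W p.1 ω) (W p.2 ω) with hY
  have hYm : AEMeasurable Y P :=
    Finset.aemeasurable_fun_sum _ fun p _ => aemeasurable_degeneratePart hW hm _ _
  have hYb : ∀ ω, |Y ω| ≤ T.offDiag.card * 2 := fun ω => by
    refine (Finset.abs_sum_le_sum_abs _ _).trans ?_
    rw [← nsmul_eq_mul]
    exact Finset.sum_le_card_nsmul _ _ _ fun p _ => br _ _
  have iY : Integrable (fun ω => Y ω ^ 2) P :=
    .of_bound (hYm.pow_const 2).aestronglyMeasurable ((T.offDiag.card * 2) ^ 2) <|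
      .of_forall fun ω => by
        rw [Real.norm_eq_abs, abs_pow]
        exact pow_le_pow_left₀ (abs_nonneg _) (hYb ω) 2
  have hpt : ∀ ω, |∑ i ∈ T, ∑ j ∈ T, degeneratePart Q h (W i ω) (W j ω)|
      ≤ 2 * m + m / 2 + (2 * m)⁻¹ * Y ω ^ 2 := by
    intro ω
    have e : ∑ i ∈ T, ∑ j ∈ T, degeneratePart Q h (W i ω) (W j ω)
        = (∑ i ∈ T, degeneratePart Q h (W i ω) (W i ω)) + Y ω := by
      rw [← Finset.sum_product', ← Finset.diag_union_offDiag,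
        Finset.sum_union (Finset.disjoint_diag_offDiag T), Finset.sum_diag]
    have h1 : |∑ i ∈ T, degeneratePart Q h (W i ω) (W i ω)| ≤ m * 2 := by
      refine (Finset.abs_sum_le_sum_abs _ _).trans ?_
      rw [hmdef, ← nsmul_eq_mul]
      exact Finset.sum_le_card_nsmul _ _ _ fun p _ => br _ _
    have h2 : |Y ω| ≤ m / 2 + (2 * m)⁻¹ * Y ω ^ 2 := by
      have h3 : m / 2 + (2 * m)⁻¹ * Y ω ^ 2 - |Y ω| = (2 * m)⁻¹ * (|Y ω| - m) ^ 2 := by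
        rw [sub_sq, sq_abs]
        field_simp
        ring
      have : 0 ≤ (2 * m)⁻¹ * (|Y ω| - m) ^ 2 := by positivity
      linarith
    rw [e]
    exact (abs_add_le _ _).trans (by linarith)
  refine (integral_mono_of_nonneg (.of_forall fun ω => abs_nonneg _)
    ((integrable_const _).add (iY.const_mul _)) (.of_forall hpt)).trans ?_
  have h8 := integral_sq_sum_offDiag_le hW hind hm hI T
  rw [integral_add' (integrable_const _) (iY.const_mul _), integral_const_mul]
  have h9 : (2 * m)⁻¹ * ∫ ω, Y ω ^ 2 ∂P ≤ (2 * m)⁻¹ * (8 * m ^ 2) :=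
    mul_le_mul_of_nonneg_left h8 (by positivity)
  have h10 : (2 * m)⁻¹ * (8 * m ^ 2) = 4 * m := by field_simp; norm_num
  simp only [integral_const, probReal_univ, one_smul]
  linarith

theorem norm_charFun_standardizedVStat_sub_le {T : Finset ℕ} (hT : 0 < T.card)
    (hσ : 0 < projSD Q h) (t : ℝ) :
    ‖∫ ω, Complex.exp (t * standardizedVStat Q h W T ω * Complex.I) ∂P
        - Real.exp (-(t ^ 2 / 2))‖
      ≤ (7 * |t| + 10 * |t| ^ 3) / (projSD Q h * √(T.card : ℝ)) + t ^ 4 / (4 * T.card) := by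
  have hmpos : (0 : ℝ) < T.card := by exact_mod_cast hT
  set ξ : E → ℝ := fun w => projLeft Q h w + projRight Q h w - 2 * kernelMean Q h with hξ
  have hξm : Measurable ξ :=
    ((measurable_projLeft hm).add (measurable_projRight hm)).sub_const _
  have hclt := norm_charFun_normalized_sum_sub_le hW hind hξm (abs_centered_proj_le hI)
    (integral_centered_proj hm hI) hσ (integral_centered_proj_sq hm hI) hT t
  have hrem := integral_abs_sum_degeneratePart_le hW hind hm hI T hT
  have hσne := hσ.ne'
  set σ : ℝ := projSD Q h with hσdef
  set m : ℝ := (T.card : ℝ) with hmdef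
  have hs : 0 < √m := Real.sqrt_pos.2 hmpos
  have hsq : √m ^ 2 = m := Real.sq_sqrt hmpos.le
  set S : Ω → ℝ := fun ω => (σ * √m)⁻¹ * ∑ i ∈ T, ξ (W i ω) with hS
  set Rm : Ω → ℝ := fun ω => ∑ i ∈ T, ∑ j ∈ T, degeneratePart Q h (W i ω) (W j ω) with hRm
  have hSm : AEMeasurable S P := (Finset.aemeasurable_fun_sum _ fun i _ =>
    hξm.comp_aemeasurable (hW i).aemeasurable).const_mul _
  have hRmm : AEMeasurable Rm P := Finset.aemeasurable_fun_sum _ fun i _ =>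
    Finset.aemeasurable_fun_sum _ fun j _ => aemeasurable_degeneratePart hW hm i j
  have hRi : Integrable (fun ω => |Rm ω|) P := by
    refine .of_bound hRmm.abs.aestronglyMeasurable (m * (m * 2)) (.of_forall fun ω => ?_)
    rw [Real.norm_eq_abs, abs_abs]
    refine (Finset.abs_sum_le_sum_abs _ _).trans ?_
    rw [hmdef, ← nsmul_eq_mul, ← nsmul_eq_mul]
    refine Finset.sum_le_card_nsmul _ _ _ fun i _ => (Finset.abs_sum_le_sum_abs _ _).trans ?_
    exact Finset.sum_le_card_nsmul _ _ _ fun j _ => abs_degeneratePart_le hI _ _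
  -- In the double sum each projection is repeated `m` times, which leaves the normalization `1/m`
  -- on the linear part.
  have hdec : ∀ ω, standardizedVStat Q h W T ω = S ω + (σ * √m * m)⁻¹ * Rm ω := by
    intro ω
    have e1 : Rm ω = (∑ i ∈ T, ∑ j ∈ T, h (W i ω) (W j ω)) - m * (∑ i ∈ T, projLeft Q h (W i ω))
        - m * (∑ i ∈ T, projRight Q h (W i ω)) + m * (m * kernelMean Q h) := by
      simp only [hRm, degeneratePart, Finset.sum_add_distrib, Finset.sum_sub_distrib,
        Finset.sum_const, nsmul_eq_mul, ← Finset.mul_sum, ← hmdef]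
    have e2 : ∑ i ∈ T, ξ (W i ω) = (∑ i ∈ T, projLeft Q h (W i ω))
        + (∑ i ∈ T, projRight Q h (W i ω)) - m * (2 * kernelMean Q h) := by
      simp only [hξ, Finset.sum_add_distrib, Finset.sum_sub_distrib, Finset.sum_const,
        nsmul_eq_mul, ← hmdef]
    simp only [standardizedVStat, vStat, hS, e1, e2, ← hσdef, ← hmdef]
    field_simp
    rw [hsq]
    ring
  have hVm : AEMeasurable (standardizedVStat Q h W T) P := by
    rw [funext hdec]
    exact hSm.add (hRmm.const_mul _)
  have hint : ∀ Y : Ω → ℝ, AEMeasurable Y P →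
      Integrable (fun ω => Complex.exp (t * Y ω * Complex.I)) P := fun Y hY => by
    refine .of_bound (by fun_prop) 1 (.of_forall fun ω => ?_)
    rw [← Complex.ofReal_mul, Complex.norm_exp_ofReal_mul_I]
  rw [charFun_apply_real, integral_map hSm (by fun_prop)] at hclt
  -- From `|exp(ix) - 1| ≤ |x|` and the `L¹` bound on the remainder.
  have hdiff : ‖∫ ω, Complex.exp (t * standardizedVStat Q h W T ω * Complex.I) ∂P
      - ∫ ω, Complex.exp (t * S ω * Complex.I) ∂P‖ ≤ 7 * |t| / (σ * √m) := by
    rw [← integral_sub (hint _ hVm) (hint _ hSm)]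
    refine (norm_integral_le_of_norm_le (hRi.const_mul (|t| * (σ * √m * m)⁻¹))
      (.of_forall fun ω => ?_)).trans ?_
    · have e : Complex.exp (t * standardizedVStat Q h W T ω * Complex.I)
          - Complex.exp (t * S ω * Complex.I)
          = Complex.exp ((t * S ω : ℝ) * Complex.I)
            * (Complex.exp (Complex.I * (t * ((σ * √m * m)⁻¹ * Rm ω) : ℝ)) - 1) := by
        rw [mul_sub, ← Complex.exp_add, hdec]
        push_cast
        ring_nf
      rw [e, norm_mul, Complex.norm_exp_ofReal_mul_I, one_mul]
      refine Real.norm_exp_I_mul_ofReal_sub_one_le.trans (le_of_eq ?_)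
      rw [Real.norm_eq_abs, abs_mul, abs_mul, abs_of_pos (by positivity : 0 < (σ * √m * m)⁻¹)]
      ring
    · rw [integral_const_mul]
      refine (mul_le_mul_of_nonneg_left hrem (by positivity)).trans (le_of_eq ?_)
      field_simp
  refine (norm_sub_le_norm_sub_add_norm_sub _ _ _).trans ((add_le_add hdiff hclt).trans ?_)
  rw [add_div]
  linarith

end Remainder

end Hoeffding

/-! ### Kernels depending on an independent training block -/

section RandomKernel

variable {Ω E 𝒟 : Type*} [MeasurableSpace Ω] [MeasurableSpace E] [MeasurableSpace 𝒟]
  {P : Measure Ω} [IsProbabilityMeasure P] {Q : Measure E} [IsProbabilityMeasure Q]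
  {W : ℕ → Ω → E}

section Measurability

variable {H : 𝒟 → E → E → ℝ} (hH : Measurable fun p : 𝒟 × E × E => H p.1 p.2.1 p.2.2)
include hH

theorem measurable_uncurry_kernel (d : 𝒟) : Measurable (Function.uncurry (H d)) :=
  hH.comp measurable_prodMk_left

theorem measurable_projLeft_kernel : Measurable fun p : 𝒟 × E => projLeft Q (H p.1) p.2 :=
  (StronglyMeasurable.integral_prod_right (ν := Q)
    (f := fun (p : 𝒟 × E) (w : E) => H p.1 p.2 w)
    (hH.comp (f := fun q : (𝒟 × E) × E => (q.1.1, q.1.2, q.2))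
      (by fun_prop)).stronglyMeasurable).measurable

theorem measurable_projRight_kernel : Measurable fun p : 𝒟 × E => projRight Q (H p.1) p.2 :=
  (StronglyMeasurable.integral_prod_right (ν := Q)
    (f := fun (p : 𝒟 × E) (w : E) => H p.1 w p.2)
    (hH.comp (f := fun q : (𝒟 × E) × E => (q.1.1, q.2, q.1.2))
      (by fun_prop)).stronglyMeasurable).measurable

theorem measurable_kernelMean_kernel : Measurable fun d => kernelMean Q (H d) :=
  (StronglyMeasurable.integral_prod_right (ν := Q)
    (f := fun (d : 𝒟) (w : E) => projLeft Q (H d) w)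
    (measurable_projLeft_kernel hH).stronglyMeasurable).measurable

variable (hI : ∀ d w w', H d w w' ∈ Set.Icc (0 : ℝ) 1)
include hI

theorem measurable_projSD_kernel : Measurable fun d => projSD Q (H d) := by
  -- Written as an integral of a jointly measurable function, the variance is measurable in the
  -- parameter.
  have e : (fun d => projSD Q (H d)) = fun d => √(∫ w, (projLeft Q (H d) w
      + projRight Q (H d) w - 2 * kernelMean Q (H d)) ^ 2 ∂Q) := by
    funext d
    rw [integral_centered_proj_sq (measurable_uncurry_kernel hH d) (hI d)]
    exact (Real.sqrt_sq (Real.sqrt_nonneg _)).symm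
  rw [e]
  refine Measurable.sqrt (StronglyMeasurable.integral_prod_right (ν := Q)
    (f := fun (d : 𝒟) (w : E) => (projLeft Q (H d) w
      + projRight Q (H d) w - 2 * kernelMean Q (H d)) ^ 2) ?_).measurable
  exact ((((measurable_projLeft_kernel hH).add (measurable_projRight_kernel hH)).sub
    (((measurable_kernelMean_kernel hH).comp measurable_fst).const_mul 2)).pow_const
      2).stronglyMeasurable

theorem measurable_standardized_kernel_sum (T : Finset ℕ) :
    Measurable fun p : 𝒟 × (T → E) => √(T.card : ℝ) / projSD Q (H p.1)
      * (1 / (T.card : ℝ) ^ 2 * ∑ i : T, ∑ j : T, H p.1 (p.2 i) (p.2 j)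
        - kernelMean Q (H p.1)) := by
  refine Measurable.mul (((measurable_projSD_kernel hH hI).comp measurable_fst).const_div _)
    (Measurable.sub (Measurable.const_mul ?_ _)
      ((measurable_kernelMean_kernel hH).comp measurable_fst))
  exact Finset.measurable_fun_sum _ fun i _ => Finset.measurable_fun_sum _ fun j _ =>
    hH.comp (f := fun p : 𝒟 × (T → E) => (p.1, p.2 i, p.2 j)) (by fun_prop)

end Measurability

-- Sums over the subtype exhibit the statistic as a function of the finite block `(W i)`, `i ∈ T`,
-- to which independence of blocks applies.
omit [MeasurableSpace Ω] [IsProbabilityMeasure Q] in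
theorem standardizedVStat_eq (h : E → E → ℝ) (T : Finset ℕ) (ω : Ω) :
    standardizedVStat Q h W T ω = √(T.card : ℝ) / projSD Q h
      * (1 / (T.card : ℝ) ^ 2 * ∑ i : T, ∑ j : T, h (W i ω) (W j ω) - kernelMean Q h) := by
  have e : ∀ i, ∑ j : T, h (W i ω) (W j ω) = ∑ j ∈ T, h (W i ω) (W j ω) := fun i =>
    Finset.sum_coe_sort T fun j => h (W i ω) (W j ω)
  simp_rw [e]
  rw [Finset.sum_coe_sort T fun i => ∑ j ∈ T, h (W i ω) (W j ω)]
  rfl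

variable {S T : Finset ℕ} {H : (S → E) → E → E → ℝ}
  (hH : Measurable fun p : (S → E) × E × E => H p.1 p.2.1 p.2.2)
  (hI : ∀ d w w', H d w w' ∈ Set.Icc (0 : ℝ) 1) (hW : ∀ i, HasLaw (W i) Q P)
include hH hI hW

omit [IsProbabilityMeasure P] in
theorem aemeasurable_standardizedVStat :
    AEMeasurable (fun ω => standardizedVStat Q (H fun i => W i ω) W T ω) P := by
  simp_rw [standardizedVStat_eq]
  exact (measurable_standardized_kernel_sum (Q := Q) hH hI T).comp_aemeasurable
    (f := fun ω => ((fun i : S => W i ω), (fun i : T => W i ω)))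
    ((aemeasurable_restrict hW S).prodMk (aemeasurable_restrict hW T))

/-- Conditioning on the training block: where `σ√m > M` the fixed-kernel bound gives at most `ε`
plus the quartic term, and elsewhere two numbers of modulus at most one differ by at most `2`. -/
theorem norm_integral_exp_standardizedVStat_sub_le (hind : iIndepFun W P) (hST : Disjoint S T)
    (hT : 0 < T.card) (t : ℝ) {ε M : ℝ} (hε : 0 ≤ ε) (hM : 0 ≤ M)
    (hεM : 7 * |t| + 10 * |t| ^ 3 ≤ ε * M) :
    ‖∫ ω, Complex.exp (t * standardizedVStat Q (H fun i => W i ω) W T ω * Complex.I) ∂P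
        - Real.exp (-(t ^ 2 / 2))‖
      ≤ ε + t ^ 4 / (4 * T.card)
        + 2 * P.real {ω | projSD Q (H fun i => W i ω) * √(T.card : ℝ) ≤ M} := by
  have hmpos : (0 : ℝ) < T.card := by exact_mod_cast hT
  have hs : 0 < √(T.card : ℝ) := Real.sqrt_pos.2 hmpos
  have hS := aemeasurable_restrict hW S
  have hTm := aemeasurable_restrict hW T
  have hin : IndepFun (fun ω (i : S) => W i ω) (fun ω (i : T) => W i ω) P :=
    hind.indepFun_finset₀ S T hST fun i => (hW i).aemeasurable
  have hp := (indepFun_iff_map_prod_eq_prod_map_map hS hTm).1 hin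
  set μS : Measure (S → E) := P.map fun ω (i : S) => W i ω with hμS
  set μT : Measure (T → E) := P.map fun ω (i : T) => W i ω with hμT
  have pS : IsProbabilityMeasure μS := Measure.isProbabilityMeasure_map hS
  have pT : IsProbabilityMeasure μT := Measure.isProbabilityMeasure_map hTm
  set G : (S → E) × (T → E) → ℝ := fun p => √(T.card : ℝ) / projSD Q (H p.1)
      * (1 / (T.card : ℝ) ^ 2 * ∑ i : T, ∑ j : T, H p.1 (p.2 i) (p.2 j)
        - kernelMean Q (H p.1)) with hG
  have hGm : Measurable G := measurable_standardized_kernel_sum hH hI T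
  have hGe : Measurable fun p => Complex.exp (t * G p * Complex.I) := by fun_prop
  set F : (S → E) → ℂ := fun d => ∫ v, Complex.exp (t * G (d, v) * Complex.I) ∂μT with hF
  have hFm : StronglyMeasurable F := StronglyMeasurable.integral_prod_right
    (f := fun (d : S → E) (v : T → E) => Complex.exp (t * G (d, v) * Complex.I))
    hGe.stronglyMeasurable
  have hexp1 : ∀ p, ‖Complex.exp (t * G p * Complex.I)‖ ≤ 1 := fun p => by
    rw [← Complex.ofReal_mul, Complex.norm_exp_ofReal_mul_I]
  have hF1 : ∀ d, ‖F d‖ ≤ 1 := fun d => by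
    have := norm_integral_le_of_norm_le_const (μ := μT)
      (f := fun v => Complex.exp (t * G (d, v) * Complex.I)) (.of_forall fun v => hexp1 (d, v))
    simpa using this
  have hFi : Integrable F μS := .of_bound hFm.aestronglyMeasurable 1 (.of_forall hF1)
  -- With `d` frozen this is a V-statistic with a deterministic kernel, so the fixed-kernel bound
  -- applies.
  have hFe : ∀ d, F d = ∫ ω, Complex.exp (t * standardizedVStat Q (H d) W T ω * Complex.I) ∂P := by
    intro d
    have hd : Measurable fun v => Complex.exp (t * G (d, v) * Complex.I) :=
      hGe.comp measurable_prodMk_left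
    simp only [hF, hμT]
    rw [integral_map hTm hd.aestronglyMeasurable]
    simp_rw [standardizedVStat_eq]
    rfl
  have hfub : ∫ ω, Complex.exp (t * standardizedVStat Q (H fun i => W i ω) W T ω * Complex.I) ∂P
      = ∫ d, F d ∂μS := by
    rw [hF, ← integral_prod (fun p => Complex.exp (t * G p * Complex.I))
      (.of_bound hGe.aestronglyMeasurable 1 (.of_forall hexp1)), ← hp,
      integral_map (hS.prodMk hTm) hGe.aestronglyMeasurable]
    simp_rw [standardizedVStat_eq]
    rfl
  set A : Set (S → E) := {d | projSD Q (H d) * √(T.card : ℝ) ≤ M} with hA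
  have hAm : MeasurableSet A :=
    measurableSet_le ((measurable_projSD_kernel hH hI).mul_const _) measurable_const
  have hPA : P.real {ω | projSD Q (H fun i => W i ω) * √(T.card : ℝ) ≤ M} = μS.real A := by
    rw [measureReal_def, measureReal_def, hμS, Measure.map_apply_of_aemeasurable hS hAm]
    rfl
  have hc : Real.exp (-(t ^ 2 / 2)) ≤ 1 := Real.exp_le_one_iff.2 (by nlinarith [sq_nonneg t])
  have ht4 : 0 ≤ t ^ 4 / (4 * (T.card : ℝ)) := by positivity
  have hbound : ∀ d, ‖F d - Real.exp (-(t ^ 2 / 2))‖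
      ≤ ε + t ^ 4 / (4 * T.card) + A.indicator (fun _ => (2 : ℝ)) d := by
    intro d
    by_cases hd : d ∈ A
    · rw [Set.indicator_of_mem hd]
      have h1 : ‖F d - Real.exp (-(t ^ 2 / 2))‖ ≤ 1 + 1 := by
        refine (norm_sub_le _ _).trans (add_le_add (hF1 d) ?_)
        rwa [Complex.norm_real, Real.norm_eq_abs, abs_of_pos (Real.exp_pos _)]
      linarith
    · rw [Set.indicator_of_notMem hd, add_zero]
      have hd' : M < projSD Q (H d) * √(T.card : ℝ) := not_le.1 hd
      have hpos : 0 < projSD Q (H d) := pos_of_mul_pos_left (hM.trans_lt hd') hs.le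
      rw [hFe]
      refine (norm_charFun_standardizedVStat_sub_le hW hind (measurable_uncurry_kernel hH d) (hI d)
        hT hpos t).trans (add_le_add ?_ le_rfl)
      rw [div_le_iff₀ (hM.trans_lt hd')]
      exact hεM.trans (mul_le_mul_of_nonneg_left hd'.le hε)
  have hi2 : Integrable (A.indicator fun _ => (2 : ℝ)) μS := (integrable_const _).indicator hAm
  have hsub : ∫ d, F d ∂μS - Real.exp (-(t ^ 2 / 2))
      = ∫ d, (F d - Real.exp (-(t ^ 2 / 2))) ∂μS := by
    rw [integral_sub hFi (integrable_const _)]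
    simp
  rw [hfub, hsub, hPA]
  refine (norm_integral_le_of_norm_le ((integrable_const _).add hi2) (.of_forall hbound)).trans
    (le_of_eq ?_)
  rw [integral_add' (integrable_const _) hi2, integral_indicator hAm]
  simp
  ring

end RandomKernel

/-! ### Passage to the limit by Lévy continuity -/

section Limit

variable {Ω E : Type*} [MeasurableSpace Ω] [MeasurableSpace E]
  {P : Measure Ω} [IsProbabilityMeasure P] {Q : Measure E} [IsProbabilityMeasure Q]
  {W : ℕ → Ω → E}

theorem tendstoInDistribution_standardizedVStat (hW : ∀ i, HasLaw (W i) Q P)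
    (hind : iIndepFun W P) (S T : ℕ → Finset ℕ) (hST : ∀ n, Disjoint (S n) (T n))
    (hT : Tendsto (fun n => (T n).card) atTop atTop)
    (H : ∀ n, (S n → E) → E → E → ℝ)
    (hH : ∀ n, Measurable fun p : (S n → E) × E × E => H n p.1 p.2.1 p.2.2)
    (hI : ∀ n d w w', H n d w w' ∈ Set.Icc (0 : ℝ) 1)
    (hσ : TendstoInProbAtTop P fun n ω =>
      projSD Q (H n fun i => W i ω) * √((T n).card : ℝ)) :
    TendstoInDistribution (fun n ω => standardizedVStat Q (H n fun i => W i ω) W (T n) ω)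
      atTop (id : ℝ → ℝ) (fun _ => P) (gaussianReal 0 1) where
  forall_aemeasurable n := aemeasurable_standardizedVStat (hH n) (hI n) hW
  tendsto := by
    refine ProbabilityMeasure.tendsto_iff_tendsto_charFun.2 fun t => ?_
    simp only [ProbabilityMeasure.coe_mk, Measure.map_id, charFun_gaussianReal]
    have hlim : Complex.exp (t * (0 : ℝ) * Complex.I - ((1 : NNReal) : ℝ) * t ^ 2 / 2)
        = ((Real.exp (-(t ^ 2 / 2)) : ℝ) : ℂ) := by
      push_cast
      congr 1
      simp
    rw [hlim, Metric.tendsto_atTop]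
    intro δ hδ
    set B : ℝ := 7 * |t| + 10 * |t| ^ 3 with hB
    have hB0 : 0 ≤ B := by positivity
    -- The threshold `3B/δ` makes the fixed-kernel error `δ/3`; the remaining terms are eventually
    -- below another `δ/3`.
    have hεM : B ≤ δ / 3 * (3 * B / δ) := by
      refine le_of_eq ?_
      field_simp
    have hM : 0 ≤ 3 * B / δ := by positivity
    have h1 : Tendsto (fun n => t ^ 4 / (4 * ((T n).card : ℝ))
        + 2 * P.real {ω | projSD Q (H n fun i => W i ω) * √((T n).card : ℝ) ≤ 3 * B / δ})
        atTop (𝓝 (0 + 2 * 0)) := by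
      refine Tendsto.add (tendsto_const_nhds.div_atTop ?_) (Tendsto.const_mul _ ?_)
      · exact (tendsto_natCast_atTop_atTop.comp hT).const_mul_atTop (by norm_num)
      · exact (ENNReal.tendsto_toReal ENNReal.zero_ne_top).comp (hσ _)
    have h2 := h1.eventually (gt_mem_nhds (by linarith : (0 : ℝ) + 2 * 0 < δ / 3))
    obtain ⟨N, hN⟩ := eventually_atTop.1 (h2.and (hT.eventually_gt_atTop 0))
    refine ⟨N, fun n hn => ?_⟩
    obtain ⟨h3, h4⟩ := hN n hn
    rw [dist_eq_norm, charFun_apply_real,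
      integral_map (aemeasurable_standardizedVStat (hH n) (hI n) hW) (by fun_prop)]
    have h5 := norm_integral_exp_standardizedVStat_sub_le (hH n) (hI n) hW hind (hST n) h4 t
      (by positivity : 0 ≤ δ / 3) hM hεM
    refine h5.trans_lt ?_
    linarith

end Limit

/-! ### The rank comparison as a kernel on marked triples -/

section Population

variable {X L : Type*} [MeasurableSpace X]

/-- The marked labelled point `((X, Y), ζ)` carried by a marked triple. -/
def firstPoint (w : (X × L × L) × ℝ × ℝ) : (X × L) × ℝ := ((w.1.1, w.1.2.1), w.2.1)

/-- The marked labelled point `((X, Y'), ζ')` carried by a marked triple. -/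
def secondPoint (w : (X × L × L) × ℝ × ℝ) : (X × L) × ℝ := ((w.1.1, w.1.2.2), w.2.2)

/-- The rank comparison as a kernel on marked triples. -/
noncomputable def rankKernel (g : X → L → ℝ) (w w' : (X × L × L) × ℝ × ℝ) : ℝ :=
  rankInd g (firstPoint w) (secondPoint w')

omit [MeasurableSpace X] in
theorem rankInd_mem_Icc (g : X → L → ℝ) (p q : (X × L) × ℝ) :
    rankInd g p q ∈ Set.Icc (0 : ℝ) 1 := by
  unfold rankInd
  split_ifs <;> simp

variable [MeasurableSpace L]

theorem measurable_firstPoint : Measurable (firstPoint : (X × L × L) × ℝ × ℝ → (X × L) × ℝ) := by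
  unfold firstPoint
  fun_prop

theorem measurable_secondPoint :
    Measurable (secondPoint : (X × L × L) × ℝ × ℝ → (X × L) × ℝ) := by
  unfold secondPoint
  fun_prop

theorem measurable_rankInd {𝒟 : Type*} [MeasurableSpace 𝒟] {G : 𝒟 → X → L → ℝ}
    (hG : Measurable fun p : 𝒟 × X × L => G p.1 p.2.1 p.2.2) :
    Measurable fun p : 𝒟 × ((X × L) × ℝ) × (X × L) × ℝ => rankInd (G p.1) p.2.1 p.2.2 := by
  have h1 : Measurable fun p : 𝒟 × ((X × L) × ℝ) × (X × L) × ℝ => G p.1 p.2.1.1.1 p.2.1.1.2 :=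
    hG.comp (f := fun p : 𝒟 × ((X × L) × ℝ) × (X × L) × ℝ => (p.1, p.2.1.1)) (by fun_prop)
  have h2 : Measurable fun p : 𝒟 × ((X × L) × ℝ) × (X × L) × ℝ => G p.1 p.2.2.1.1 p.2.2.1.2 :=
    hG.comp (f := fun p : 𝒟 × ((X × L) × ℝ) × (X × L) × ℝ => (p.1, p.2.2.1)) (by fun_prop)
  have h3 : MeasurableSet {p : 𝒟 × ((X × L) × ℝ) × (X × L) × ℝ | p.2.1.2 < p.2.2.2} :=
    measurableSet_lt (by fun_prop) (by fun_prop)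
  exact Measurable.ite ((measurableSet_lt h1 h2).union ((measurableSet_eq_fun h1 h2).inter h3))
    measurable_const measurable_const

theorem measurable_rankKernel {𝒟 : Type*} [MeasurableSpace 𝒟] {G : 𝒟 → X → L → ℝ}
    (hG : Measurable fun p : 𝒟 × X × L => G p.1 p.2.1 p.2.2) :
    Measurable fun p : 𝒟 × ((X × L × L) × ℝ × ℝ) × ((X × L × L) × ℝ × ℝ) =>
      rankKernel (G p.1) p.2.1 p.2.2 :=
  (measurable_rankInd hG).comp (measurable_fst.prodMk
    ((measurable_firstPoint.comp (measurable_fst.comp measurable_snd)).prodMk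
      (measurable_secondPoint.comp (measurable_snd.comp measurable_snd))))

variable [Fintype L] (PX : Measure X) [IsProbabilityMeasure PX] (η ηhat : ProbClassifier X L)
  (ν : Measure ℝ) [IsProbabilityMeasure ν]

instance : IsProbabilityMeasure (pointLaw PX η ν) := by
  unfold pointLaw
  infer_instance

instance : IsProbabilityMeasure (tripleLaw PX η ηhat ν) := by
  unfold tripleLaw
  infer_instance

/-- Forgetting `Y'` and `ζ'` takes the first marginal of the product kernel and of the marks. This
identifies the abstract projections with `phi` and `psi`. -/
theorem map_firstPoint_tripleLaw :
    (tripleLaw PX η ηhat ν).map firstPoint = pointLaw PX η ν := by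
  have h1 : (firstPoint : (X × L × L) × ℝ × ℝ → (X × L) × ℝ)
      = Prod.map (Prod.map id Prod.fst) Prod.fst := rfl
  rw [h1, tripleLaw, ← Measure.map_prod_map _ _ (by fun_prop) (by fun_prop),
    ← Measure.compProd_map (by fun_prop), ← Kernel.fst_eq, Kernel.fst_prod, ← Measure.fst,
    Measure.fst_prod, pointLaw]

theorem map_secondPoint_tripleLaw :
    (tripleLaw PX η ηhat ν).map secondPoint = pointLaw PX ηhat ν := by
  have h1 : (secondPoint : (X × L × L) × ℝ × ℝ → (X × L) × ℝ)
      = Prod.map (Prod.map id Prod.snd) Prod.snd := rfl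
  rw [h1, tripleLaw, ← Measure.map_prod_map _ _ (by fun_prop) (by fun_prop),
    ← Measure.compProd_map (by fun_prop), ← Kernel.snd_eq, Kernel.snd_prod, ← Measure.snd,
    Measure.snd_prod, pointLaw]

variable {g : X → L → ℝ} (hg : Measurable (Function.uncurry g))
include hg

omit [Fintype L] in
theorem measurable_uncurry_rankInd :
    Measurable fun r : ((X × L) × ℝ) × (X × L) × ℝ => rankInd g r.1 r.2 :=
  (measurable_rankInd (𝒟 := Unit) (G := fun _ => g) (hg.comp measurable_snd)).comp
    (f := fun r : ((X × L) × ℝ) × (X × L) × ℝ => ((), r)) (by fun_prop)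

omit [Fintype L] in
theorem measurable_uncurry_rankKernel : Measurable (Function.uncurry (rankKernel g)) :=
  (measurable_uncurry_rankInd hg).comp ((measurable_firstPoint.comp measurable_fst).prodMk
    (measurable_secondPoint.comp measurable_snd))

theorem measurable_phi : Measurable (phi PX ηhat ν g) :=
  (StronglyMeasurable.integral_prod_right (ν := pointLaw PX ηhat ν) (f := rankInd g)
    (measurable_uncurry_rankInd hg).stronglyMeasurable).measurable

theorem projLeft_rankKernel (w : (X × L × L) × ℝ × ℝ) :
    projLeft (tripleLaw PX η ηhat ν) (rankKernel g) w = phi PX ηhat ν g (firstPoint w) := by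
  have hm : Measurable (rankInd g (firstPoint w)) :=
    (measurable_uncurry_rankInd hg).comp measurable_prodMk_left
  rw [phi, ← map_secondPoint_tripleLaw PX η ηhat ν,
    integral_map measurable_secondPoint.aemeasurable hm.aestronglyMeasurable]
  rfl

theorem projRight_rankKernel (w : (X × L × L) × ℝ × ℝ) :
    projRight (tripleLaw PX η ηhat ν) (rankKernel g) w = psi PX η ν g (secondPoint w) := by
  have hm : Measurable fun p => rankInd g p (secondPoint w) :=
    (measurable_uncurry_rankInd hg).comp measurable_prodMk_right
  rw [psi, ← map_firstPoint_tripleLaw PX η ηhat ν,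
    integral_map measurable_firstPoint.aemeasurable hm.aestronglyMeasurable]
  rfl

theorem kernelMean_rankKernel :
    kernelMean (tripleLaw PX η ηhat ν) (rankKernel g) = rankMean PX η ηhat ν g := by
  have hi : Integrable (fun r : ((X × L) × ℝ) × (X × L) × ℝ => rankInd g r.1 r.2)
      ((pointLaw PX η ν).prod (pointLaw PX ηhat ν)) :=
    integrable_of_abs_le (C := 1) (measurable_uncurry_rankInd hg) fun r =>
      (abs_of_nonneg (rankInd_mem_Icc g _ _).1).trans_le (rankInd_mem_Icc g _ _).2
  rw [kernelMean, rankMean, integral_prod _ hi]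
  simp_rw [projLeft_rankKernel PX η ηhat ν hg]
  rw [← map_firstPoint_tripleLaw PX η ηhat ν]
  exact (integral_map measurable_firstPoint.aemeasurable
    (measurable_phi PX ηhat ν hg).aestronglyMeasurable).symm

theorem projSD_rankKernel :
    projSD (tripleLaw PX η ηhat ν) (rankKernel g) = rankSD PX η ηhat ν g := by
  simp_rw [projSD, projLeft_rankKernel PX η ηhat ν hg, projRight_rankKernel PX η ηhat ν hg]
  rfl

end Population

end RankSum

/-! ### The rank-sum statistic -/

theorem mainTheorem2 {X L Ω : Type*} [MeasurableSpace X] [Fintype L] [MeasurableSpace L]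
    [MeasurableSingletonClass L] [MeasurableSpace Ω]
    (P : Measure Ω) [IsProbabilityMeasure P]
    (PX : Measure X) [IsProbabilityMeasure PX]
    (η ηhat : RankSum.ProbClassifier X L)
    (ν : Measure ℝ) [IsProbabilityMeasure ν]
    -- the distinguisher procedure
    (D : RankSum.Distinguisher X L)
    (hD : ∀ m, Measurable fun p : (Fin m → X × L × L) × X × L => D m p.1 p.2.1 p.2.2)
    -- i.i.d. triples `(X_i, Y_i, Y'_i)` and tie-breaking marks `(ζ_i, ζ'_i)`
    (Z : ℕ → Ω → X × L × L) (ζ ζ' : ℕ → Ω → ℝ)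
    (hlaw : ∀ i, HasLaw (fun ω => (Z i ω, ζ i ω, ζ' i ω)) (RankSum.tripleLaw PX η ηhat ν) P)
    (hindep : iIndepFun (fun i ω => (Z i ω, ζ i ω, ζ' i ω)) P)
    -- the two splits
    (I₁ I₂ : ℕ → Finset ℕ) (hdisj : ∀ n, Disjoint (I₁ n) (I₂ n))
    (h₁ : Tendsto (fun n => (I₁ n).card) atTop atTop)
    (h₂ : Tendsto (fun n => (I₂ n).card) atTop atTop)
    (hσ : RankSum.TendstoInProbAtTop P fun n ω =>
      RankSum.rankSD PX η ηhat ν (RankSum.fittedScore D Z (I₁ n) ω) ^ 3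
        * Real.sqrt ((I₂ n).card : ℝ)) :
    TendstoInDistribution
      (fun n ω =>
        Real.sqrt ((I₂ n).card : ℝ)
            / RankSum.rankSD PX η ηhat ν (RankSum.fittedScore D Z (I₁ n) ω)
          * (RankSum.rankSum (RankSum.fittedScore D Z (I₁ n) ω) Z ζ ζ' (I₂ n) ω
              - RankSum.rankMean PX η ηhat ν (RankSum.fittedScore D Z (I₁ n) ω)))
      atTop (id : ℝ → ℝ) (fun _ => P) (gaussianReal 0 1) := by
  -- The fitted score as a function of the marked training block, with the marks ignored:
  -- independence is available for marked triples.
  let G : ∀ n, (I₁ n → (X × L × L) × ℝ × ℝ) → X → L → ℝ := fun n d =>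
    D (I₁ n).card fun k => (d ⟨(I₁ n).orderEmbOfFin rfl k, (I₁ n).orderEmbOfFin_mem rfl k⟩).1
  have hG : ∀ n, Measurable fun p : (I₁ n → (X × L × L) × ℝ × ℝ) × X × L =>
      G n p.1 p.2.1 p.2.2 := fun n =>
    (hD (I₁ n).card).comp (f := fun p : (I₁ n → (X × L × L) × ℝ × ℝ) × X × L =>
      ((fun k => (p.1 ⟨(I₁ n).orderEmbOfFin rfl k, (I₁ n).orderEmbOfFin_mem rfl k⟩).1), p.2))
      (by fun_prop)
  have hg : ∀ n ω, Measurable (Function.uncurry (RankSum.fittedScore D Z (I₁ n) ω)) :=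
    fun n ω => (hD (I₁ n).card).comp measurable_prodMk_left
  have hI : ∀ n d w w', RankSum.rankKernel (G n d) w w' ∈ Set.Icc (0 : ℝ) 1 :=
    fun n d w w' => RankSum.rankInd_mem_Icc _ _ _
  have hσ' : RankSum.TendstoInProbAtTop P fun n ω =>
      RankSum.projSD (RankSum.tripleLaw PX η ηhat ν)
        (RankSum.rankKernel (G n fun i => (Z i ω, ζ i ω, ζ' i ω))) * √((I₂ n).card : ℝ) := by
    intro M
    -- Since `0 ≤ σ ≤ 1`, `σ³ ≤ σ`, so the event `σ√m ≤ M` is contained in `σ³√m ≤ M`.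
    refine tendsto_of_tendsto_of_tendsto_of_le_of_le tendsto_const_nhds (hσ M)
      (fun n => zero_le) fun n => measure_mono fun ω hω => ?_
    have h1 : RankSum.projSD (RankSum.tripleLaw PX η ηhat ν)
        (RankSum.rankKernel (RankSum.fittedScore D Z (I₁ n) ω)) ≤ 1 :=
      RankSum.projSD_le_one (RankSum.measurable_uncurry_rankKernel (hg n ω))
        fun w w' => RankSum.rankInd_mem_Icc _ _ _
    have h2 : RankSum.projSD (RankSum.tripleLaw PX η ηhat ν)
        (RankSum.rankKernel (RankSum.fittedScore D Z (I₁ n) ω)) * √((I₂ n).card : ℝ) ≤ M := hω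
    rw [RankSum.projSD_rankKernel PX η ηhat ν (hg n ω)] at h1 h2
    exact (mul_le_mul_of_nonneg_right (pow_le_of_le_one (Real.sqrt_nonneg _) h1 three_ne_zero)
      (Real.sqrt_nonneg _)).trans h2
  have main := RankSum.tendstoInDistribution_standardizedVStat hlaw hindep I₁ I₂ hdisj h₂
    (fun n d => RankSum.rankKernel (G n d)) (fun n => RankSum.measurable_rankKernel (hG n)) hI hσ'
  convert main using 3 with n ω
  rw [← RankSum.projSD_rankKernel PX η ηhat ν (hg n ω),
    ← RankSum.kernelMean_rankKernel PX η ηhat ν (hg n ω)]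
  rfl
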